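/- Let $n\ge 1$. Let $F_n$ be the free Heyting algebra on $n$ generators, realised as the algebra of propositional formulas in variables $P_1,\dots,P_n$ modulo provable equivalence in the intuitionistic propositional calculus. Let $K_n=\bigcup_{d\ge 0}K_n^d$ be the Kripke model defined as follows. Put $K_n^{-1}=\emptyset$. The elements of $K_n^{d}\setminus K_n^{d-1}$ are the formal points $w_{\beta,Y}$ such that $Y\subseteq K_n^{d-1}$ is a decreasing set which, if $d>0$, is not contained in $K_n^{d-2}$; $\beta\subseteq\{P_1,\dots,P_n\}$ satisfies $\beta\subseteq \mathrm{val}(w')$ for all $w'\in Y$; and if $Y$ is the decreasing set generated by one point $w'$, then $\beta\ne\mathrm{val}(w')$. The valuation is $\mathrm{val}(w_{\beta,Y})=\beta$, and the partial order is given by $w\le w_{\beta,Y}$ iff $w\in Y$ or $w=w_{\beta,Y}$. Validity of formulas at a point $w$ is defined by: $w\models P_i$ iff $P_i\in\mathrm{val}(w)$; never $w\models\bot$; the classical clauses for $\wedge$ and $\vee$; and $w\models\varphi\to\psi$ iff for all $w'\le w$, $w'\models\varphi$ implies $w'\models\psi$. Let $\widehat F_n$ be the Heyting algebra of all decreasing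 subsets of $(K_n,\le)$, ordered by inclusion (the completion of $F_n$), and let $\iota:F_n\to\widehat F_n$, $[\varphi]\mapsto\{w\in K_n: w\models\varphi\}$, be the canonical map, by which $F_n$ is identified with a subalgebra of $\widehat F_n$. If $F_n$ and $\widehat F_n$ are elementarily equivalent in the first-order language $\{0,1,\sqcap,\sqcup,\to\}$ of Heyting algebras, then $F_n$ is an elementary substructure of $\widehat F_n$; that is, $\iota$ is an elementary embedding. -/

import Mathlib

/-! ## The first-order language of Heyting algebras -/

/-- Function symbols `0, 1, ⊓, ⊔, →` of the language of Heyting algebras. -/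
inductive HeytingFunc : ℕ → Type
  | zero : HeytingFunc 0
  | one : HeytingFunc 0
  | meet : HeytingFunc 2
  | join : HeytingFunc 2
  | imp : HeytingFunc 2

/-- The language of Heyting algebras; it has no relation symbols besides equality. -/
def LHA : FirstOrder.Language.{0, 0} := ⟨HeytingFunc, fun _ => Empty⟩

/-- Every Heyting algebra is a structure for the language of Heyting algebras. -/
instance heytingStructure (H : Type*) [HeytingAlgebra H] : LHA.Structure H where
  funMap := fun {_} f =>
    match f with
    | HeytingFunc.zero => fun _ => ⊥
    | HeytingFunc.one => fun _ => ⊤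
    | HeytingFunc.meet => fun v => v 0 ⊓ v 1
    | HeytingFunc.join => fun v => v 0 ⊔ v 1
    | HeytingFunc.imp => fun v => v 0 ⇨ v 1
  RelMap := fun {_} r => r.elim

/-! ## Intuitionistic propositional logic in `n` variables and the free Heyting algebra -/

/-- Propositional formulas in the variables `P_i`, `i : Fin n`. -/
inductive Fml (n : ℕ) : Type
  | var (i : Fin n) : Fml n
  | bot : Fml n
  | and (φ ψ : Fml n) : Fml n
  | or (φ ψ : Fml n) : Fml n
  | imp (φ ψ : Fml n) : Fml n

/-- Derivability in the intuitionistic propositional calculus (Hilbert-style axiomatisation). -/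
inductive IPC {n : ℕ} : Fml n → Prop
  | k (φ ψ : Fml n) : IPC (.imp φ (.imp ψ φ))
  | s (φ ψ χ : Fml n) :
      IPC (.imp (.imp φ (.imp ψ χ)) (.imp (.imp φ ψ) (.imp φ χ)))
  | andLeft (φ ψ : Fml n) : IPC (.imp (.and φ ψ) φ)
  | andRight (φ ψ : Fml n) : IPC (.imp (.and φ ψ) ψ)
  | andIntro (φ ψ : Fml n) : IPC (.imp φ (.imp ψ (.and φ ψ)))
  | orLeft (φ ψ : Fml n) : IPC (.imp φ (.or φ ψ))
  | orRight (φ ψ : Fml n) : IPC (.imp ψ (.or φ ψ))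
  | orElim (φ ψ χ : Fml n) :
      IPC (.imp (.imp φ χ) (.imp (.imp ψ χ) (.imp (.or φ ψ) χ)))
  | exFalso (φ : Fml n) : IPC (.imp .bot φ)
  | mp (φ ψ : Fml n) : IPC (.imp φ ψ) → IPC φ → IPC ψ

namespace IPC

variable {n : ℕ} {φ ψ χ : Fml n}

theorem weaken (h : IPC φ) : IPC (.imp ψ φ) := mp _ _ (k _ _) h

theorem app (h : IPC (.imp χ (.imp φ ψ))) (h' : IPC (.imp χ φ)) : IPC (.imp χ ψ) :=
  mp _ _ (mp _ _ (s _ _ _) h) h'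

theorem refl (φ : Fml n) : IPC (.imp φ φ) := app (k φ (.imp φ φ)) (k φ φ)

theorem comp (h : IPC (.imp φ ψ)) (h' : IPC (.imp ψ χ)) : IPC (.imp φ χ) :=
  app (weaken h') h

theorem pair (h : IPC (.imp χ φ)) (h' : IPC (.imp χ ψ)) : IPC (.imp χ (.and φ ψ)) :=
  app (comp h (andIntro _ _)) h'

theorem cases (h : IPC (.imp φ χ)) (h' : IPC (.imp ψ χ)) : IPC (.imp (.or φ ψ) χ) :=
  mp _ _ (mp _ _ (orElim _ _ _) h) h'

theorem curry (h : IPC (.imp (.and φ ψ) χ)) : IPC (.imp φ (.imp ψ χ)) :=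
  comp (andIntro φ ψ) (mp _ _ (s _ _ _) (weaken h))

theorem uncurry (h : IPC (.imp φ (.imp ψ χ))) : IPC (.imp (.and φ ψ) χ) :=
  app (comp (andLeft _ _) h) (andRight _ _)

end IPC

/-- Provable equivalence of formulas. -/
instance ipcSetoid (n : ℕ) : Setoid (Fml n) where
  r φ ψ := IPC (.imp φ ψ) ∧ IPC (.imp ψ φ)
  iseqv :=
    { refl := fun φ => ⟨IPC.refl φ, IPC.refl φ⟩
      symm := fun h => ⟨h.2, h.1⟩
      trans := fun h h' => ⟨h.1.comp h'.1, h'.2.comp h.2⟩ }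

/-- The free Heyting algebra on `n` generators: formulas in `n` variables
modulo provable equivalence in intuitionistic propositional logic. -/
def Fr (n : ℕ) : Type := Quotient (ipcSetoid n)

/-- The class of a formula in the free Heyting algebra. -/
def Fr.mk {n : ℕ} (φ : Fml n) : Fr n := Quotient.mk (ipcSetoid n) φ

/-- The Lindenbaum order `[φ] ≤ [ψ] ↔ ⊢ φ → ψ`, with the operations induced by the connectives. -/
instance frHeytingAlgebra (n : ℕ) : HeytingAlgebra (Fr n) where
  le := Quotient.lift₂ (fun φ ψ => IPC (.imp φ ψ)) (by
    intro a b c d h h'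
    exact propext ⟨fun e => (h.2.comp e).comp h'.1, fun e => (h.1.comp e).comp h'.2⟩)
  le_refl := by rintro ⟨a⟩; exact IPC.refl a
  le_trans := by rintro ⟨a⟩ ⟨b⟩ ⟨c⟩ h h'; exact IPC.comp h h'
  le_antisymm := by rintro ⟨a⟩ ⟨b⟩ h h'; exact Quotient.sound ⟨h, h'⟩
  sup := Quotient.map₂ Fml.or (by
    intro a b h c d h'
    exact ⟨IPC.cases (h.1.comp (.orLeft _ _)) (h'.1.comp (.orRight _ _)),
      IPC.cases (h.2.comp (.orLeft _ _)) (h'.2.comp (.orRight _ _))⟩)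
  le_sup_left := by rintro ⟨a⟩ ⟨b⟩; exact IPC.orLeft a b
  le_sup_right := by rintro ⟨a⟩ ⟨b⟩; exact IPC.orRight a b
  sup_le := by rintro ⟨a⟩ ⟨b⟩ ⟨c⟩ h h'; exact IPC.cases h h'
  inf := Quotient.map₂ Fml.and (by
    intro a b h c d h'
    exact ⟨IPC.pair ((IPC.andLeft _ _).comp h.1) ((IPC.andRight _ _).comp h'.1),
      IPC.pair ((IPC.andLeft _ _).comp h.2) ((IPC.andRight _ _).comp h'.2)⟩)
  inf_le_left := by rintro ⟨a⟩ ⟨b⟩; exact IPC.andLeft a b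
  inf_le_right := by rintro ⟨a⟩ ⟨b⟩; exact IPC.andRight a b
  le_inf := by rintro ⟨a⟩ ⟨b⟩ ⟨c⟩ h h'; exact IPC.pair h h'
  top := Fr.mk (.imp .bot .bot)
  le_top := by rintro ⟨a⟩; exact IPC.weaken (IPC.refl _)
  himp := Quotient.map₂ Fml.imp (by
    have key : ∀ a b c d : Fml n, IPC (.imp b a) → IPC (.imp c d) →
        IPC (.imp (.imp a c) (.imp b d)) := fun a b c d h h' =>
      IPC.curry ((IPC.app (IPC.andLeft _ _) ((IPC.andRight _ _).comp h)).comp h')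
    intro a b h c d h'
    exact ⟨key _ _ _ _ h.2 h'.1, key _ _ _ _ h.1 h'.2⟩)
  le_himp_iff := by rintro ⟨a⟩ ⟨b⟩ ⟨c⟩; exact ⟨IPC.uncurry, IPC.curry⟩
  bot := Fr.mk .bot
  bot_le := by rintro ⟨a⟩; exact IPC.exFalso a
  compl := Quotient.map (fun φ => Fml.imp φ .bot) (by
    have key : ∀ a b : Fml n, IPC (.imp b a) → IPC (.imp (.imp a .bot) (.imp b .bot)) :=
      fun a b h => IPC.curry (IPC.app (IPC.andLeft _ _) ((IPC.andRight _ _).comp h))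
    intro a b h
    exact ⟨key _ _ h.2, key _ _ h.1⟩)
  himp_bot := by rintro ⟨a⟩; rfl

/-! ## The generic Kripke model

Points are formal objects `w β Y`, for a valuation `β` and a finite set `Y` of points.
They are realised as natural numbers through an injective coding of pairs `(β, Y)`. -/

/-- The formal point `w_{β,Y}`; a valuation is the set of variables it makes true. -/
def wPt {n : ℕ} (β : Finset (Fin n)) (Y : Finset ℕ) : ℕ := Encodable.encode (β, Y)

/-- The pair `(β, Y)` coded by a point `w_{β,Y}` (and `(∅, ∅)` on numbers that code nothing). -/
def ptData (n : ℕ) (x : ℕ) : Finset (Fin n) × Finset ℕ :=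
  (Encodable.decode x).getD (∅, ∅)

/-- The valuation `β` of `w_{β,Y}`. -/
def ptVal (n : ℕ) (x : ℕ) : Finset (Fin n) := (ptData n x).1

/-- The set `Y` of `w_{β,Y}`. -/
def ptBelow (n : ℕ) (x : ℕ) : Finset ℕ := (ptData n x).2

/-- `x ≤ w_{β,Y}` iff `x ∈ Y` or `x = w_{β,Y}`. -/
def ptLe (n : ℕ) (x y : ℕ) : Prop := x ∈ ptBelow n y ∨ x = y

@[simp] theorem ptVal_wPt {n : ℕ} (β : Finset (Fin n)) (Y : Finset ℕ) :
    ptVal n (wPt β Y) = β := by simp [ptVal, ptData, wPt]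

@[simp] theorem ptBelow_wPt {n : ℕ} (β : Finset (Fin n)) (Y : Finset ℕ) :
    ptBelow n (wPt β Y) = Y := by simp [ptBelow, ptData, wPt]

/-- For `A` one of the stages, `Y` and `β` satisfy the conditions that relate `w_{β,Y}` to `A`:
`Y` is a decreasing subset of `A`; `β` is contained in the valuation of every point of `Y`;
and if `Y` is the decreasing set generated by a point, then `β` is not its valuation. -/
def Admissible {n : ℕ} (A : Set ℕ) (β : Finset (Fin n)) (Y : Finset ℕ) : Prop :=
  (∀ y ∈ Y, y ∈ A) ∧
  (∀ y ∈ Y, ∀ x ∈ A, ptLe n x y → x ∈ Y) ∧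
  (∀ y ∈ Y, β ⊆ ptVal n y) ∧
  (∀ v ∈ A, (∀ x, x ∈ Y ↔ x ∈ A ∧ ptLe n x v) → β ≠ ptVal n v)

/-- `stage n d` is the set `K_n^{d-1}`: it is empty for `d = 0`, and the points of
`K_n^d` outside `K_n^{d-1}` are the admissible `w_{β,Y}` with `Y ⊆ K_n^{d-1}` and, if `d > 0`,
`Y ⊈ K_n^{d-2}`. -/
def stage (n : ℕ) : ℕ → Set ℕ
  | 0 => ∅
  | 1 => {x | ∃ (β : Finset (Fin n)) (Y : Finset ℕ), x = wPt β Y ∧ Admissible ∅ β Y}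
  | d + 2 => stage n (d + 1) ∪
      {x | ∃ (β : Finset (Fin n)) (Y : Finset ℕ), x = wPt β Y ∧
        Admissible (stage n (d + 1)) β Y ∧ ¬ (∀ y ∈ Y, y ∈ stage n d)}

theorem stage_succ_cases {n d x : ℕ} (h : x ∈ stage n (d + 1)) :
    x ∈ stage n d ∨ ∃ (β : Finset (Fin n)) (Y : Finset ℕ), x = wPt β Y ∧
      Admissible (stage n d) β Y := by
  cases d with
  | zero => exact Or.inr h
  | succ d =>
    rcases h with h | ⟨β, Y, h1, h2, -⟩
    · exact Or.inl h
    · exact Or.inr ⟨β, Y, h1, h2⟩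

theorem stage_subset_succ (n d : ℕ) : stage n d ⊆ stage n (d + 1) := by
  cases d with
  | zero => exact Set.empty_subset _
  | succ d => exact Set.subset_union_left

/-- Every point of a stage is an admissible `w_{β,Y}` over an earlier stage. -/
theorem exists_admissible {n : ℕ} : ∀ {d x : ℕ}, x ∈ stage n d →
    ∃ e, e < d ∧ stage n e ⊆ stage n d ∧ Admissible (stage n e) (ptVal n x) (ptBelow n x)
  | 0, _, h => h.elim
  | d + 1, x, h => by
    rcases stage_succ_cases h with h | ⟨β, Y, rfl, hA⟩
    · obtain ⟨e, he, hs, ha⟩ := exists_admissible h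
      exact ⟨e, by omega, hs.trans (stage_subset_succ n d), ha⟩
    · exact ⟨d, by omega, stage_subset_succ n d, by simpa using hA⟩

theorem ptBelow_mem_stage {n d x y : ℕ} (hy : y ∈ stage n d) (hx : x ∈ ptBelow n y) :
    x ∈ stage n d := by
  obtain ⟨e, -, hs, ha⟩ := exists_admissible hy
  exact hs (ha.1 x hx)

theorem not_ptBelow_both {n : ℕ} (d : ℕ) : ∀ x y : ℕ, y ∈ stage n d →
    x ∈ ptBelow n y → y ∈ ptBelow n x → False := by
  induction d using Nat.strong_induction_on with
  | _ d ih =>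
    intro x y hy hxy hyx
    obtain ⟨e, he, -, ha⟩ := exists_admissible hy
    exact ih e he y x (ha.1 x hxy) hyx hxy

/-- The set of points of the generic Kripke model, the union of its stages. -/
def K (n : ℕ) : Type := {x : ℕ // ∃ d, x ∈ stage n d}

/-- The valuation of a point: the set of (indices of) variables that are true there. -/
def K.val {n : ℕ} (w : K n) : Finset (Fin n) := ptVal n w.1

instance kPartialOrder (n : ℕ) : PartialOrder (K n) where
  le v w := ptLe n v.1 w.1
  le_refl w := Or.inr rfl
  le_trans := by
    rintro ⟨x, hx⟩ ⟨y, hy⟩ ⟨z, d, hz⟩ h h'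
    rcases h' with h' | h'
    · rcases h with h | h
      · obtain ⟨e, -, -, ha⟩ := exists_admissible hz
        exact Or.inl (ha.2.1 y h' x (ptBelow_mem_stage (ha.1 y h') h) (Or.inl h))
      · change x = y at h
        subst h
        exact Or.inl h'
    · change y = z at h'
      subst h'
      exact h
  le_antisymm := by
    rintro ⟨x, hx⟩ ⟨y, d, hy⟩ h h'
    rcases h with h | h
    · rcases h' with h' | h'
      · exact (not_ptBelow_both d x y hy h h').elim
      · exact Subtype.ext h'.symm
    · exact Subtype.ext h

theorem K.val_anti {n : ℕ} {v w : K n} (h : v ≤ w) : w.val ⊆ v.val := by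
  obtain ⟨z, d, hz⟩ := w
  rcases h with h | h
  · obtain ⟨e, -, -, ha⟩ := exists_admissible hz
    exact ha.2.2.1 v.1 h
  · change v.1 = z at h
    subst h
    exact Finset.Subset.refl _

/-- The completion of the free Heyting algebra: the Heyting algebra of decreasing sets of `K n`,
ordered by inclusion. -/
abbrev Fco (n : ℕ) : Type := LowerSet (K n)

/-- Kripke validity of a formula at a point (the order is reversed with respect to the usual
convention: truth is inherited downwards). -/
def Forces {n : ℕ} : K n → Fml n → Prop
  | w, .var i => i ∈ w.val
  | _, .bot => False
  | w, .and φ ψ => Forces w φ ∧ Forces w ψ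
  | w, .or φ ψ => Forces w φ ∨ Forces w ψ
  | w, .imp φ ψ => ∀ v ≤ w, Forces v φ → Forces v ψ

theorem Forces.mono {n : ℕ} {φ : Fml n} : ∀ {v w : K n}, v ≤ w → Forces w φ → Forces v φ := by
  induction φ with
  | var i => exact fun h hw => K.val_anti h hw
  | bot => exact fun _ hw => hw
  | and φ ψ ih1 ih2 => exact fun h hw => ⟨ih1 h hw.1, ih2 h hw.2⟩
  | or φ ψ ih1 ih2 => exact fun h hw => hw.imp (ih1 h) (ih2 h)
  | imp φ ψ _ _ => exact fun h hw u hu => hw u (hu.trans h)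

/-- The set of points at which a formula is valid, an element of the completion. -/
def truthSet {n : ℕ} (φ : Fml n) : Fco n :=
  ⟨{w | Forces w φ}, fun _ _ h hw => Forces.mono h hw⟩

theorem forces_of_ipc {n : ℕ} {φ : Fml n} (h : IPC φ) : ∀ w : K n, Forces w φ := by
  induction h with
  | k φ ψ => exact fun w v _ hv u hu _ => hv.mono hu
  | s φ ψ χ =>
    exact fun w v _ hv u hu hu' t ht ht' => hv t (ht.trans hu) ht' t le_rfl (hu' t ht ht')
  | andLeft φ ψ => exact fun w v _ hv => hv.1
  | andRight φ ψ => exact fun w v _ hv => hv.2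
  | andIntro φ ψ => exact fun w v _ hv u hu hu' => ⟨hv.mono hu, hu'⟩
  | orLeft φ ψ => exact fun w v _ hv => Or.inl hv
  | orRight φ ψ => exact fun w v _ hv => Or.inr hv
  | orElim φ ψ χ =>
    exact fun w v _ hv u hu hu' t ht ht' =>
      ht'.elim (hv t (ht.trans hu)) (hu' t ht)
  | exFalso φ => exact fun w v _ hv => hv.elim
  | mp φ ψ _ _ ih1 ih2 => exact fun w => ih1 w w le_rfl (ih2 w)

/-- The canonical map `[φ] ↦ {w | w ⊨ φ}` of the free Heyting algebra into its completion. -/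
def canonicalMap (n : ℕ) : Fr n → Fco n :=
  Quotient.lift truthSet (by
    intro φ ψ h
    ext w
    exact ⟨fun hw => forces_of_ipc h.1 w w le_rfl hw, fun hw => forces_of_ipc h.2 w w le_rfl hw⟩)

/-!
The generic Kripke model `K n` is universal: every poset with finite principal ideals that carries
an antitone family of valuations has a valuation preserving p-morphism to it
(`exists_pMorphism`), because every admissible point exists. Applied to a finite quotient of the
canonical model of prime ideals, this gives the completeness of `K n`
(`Fr.mk_le_mk_of_forces`), so the canonical map is an order embedding. Its image contains the
decreasing sets generated by single points (`exists_forces_iff_le`), and it follows that the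
elements of the free algebra with a largest element strictly below them are exactly these sets.

Consequently the generators have the following first-order property (`SeparatesIrreducibles`),
both in the free algebra and in the completion: two such elements lying below the same generators
are equal if they have the same lower cover, and no such element lies below the same generators as
its lower cover, if that is again such an element.
Conversely, let a tuple `x` in the completion have this property. It defines a
new family of valuations on the poset `K n`, hence a p-morphism from `K n` to itself, and the
property says that this p-morphism is injective. As `K n` has finitely many points of each
bounded height, it is an automorphism of the poset, so `x` is conjugate to the generators under an
automorphism of the completion (`exists_orderIso_of_separatesIrreducibles`).

If the two algebras are elementarily equivalent and a formula `θ` holds at the generators of the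
free algebra, then the sentence saying that some tuple has the property and satisfies `θ` passes to
the completion, where all tuples with the property have the same type as the generators. So the
generators have the same type in both algebras, and since they generate the free algebra, the
canonical map is elementary.
-/

/-! ### The order of the generic Kripke model -/

namespace K

variable {n : ℕ}

theorem lt_iff {v w : K n} : v < w ↔ v.1 ∈ ptBelow n w.1 := by
  constructor
  · intro h
    exact h.le.resolve_right fun e => h.ne (Subtype.ext e)
  · intro h
    refine lt_of_le_of_ne (Or.inl h) ?_
    rintro rfl
    obtain ⟨d, hd⟩ := v.2
    exact not_ptBelow_both d _ _ hd h h

theorem finite_Iio (w : K n) : (Set.Iio w).Finite := by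
  refine Set.Finite.of_finite_image (f := Subtype.val)
    ((ptBelow n w.1).finite_toSet.subset ?_) Subtype.val_injective.injOn
  rintro _ ⟨v, hv, rfl⟩
  exact lt_iff.1 hv

theorem finite_Iic (w : K n) : (Set.Iic w).Finite := by
  rw [← Set.Iio_insert]
  exact (finite_Iio w).insert w

theorem eq_wPt_of_mem_stage : ∀ {d x : ℕ}, x ∈ stage n d → x = wPt (ptVal n x) (ptBelow n x)
  | 0, _, h => h.elim
  | d + 1, x, h => by
    rcases stage_succ_cases h with h | ⟨β, Y, rfl, -⟩
    · exact eq_wPt_of_mem_stage h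
    · simp

/-- A point is determined by its valuation and the points strictly below it. -/
theorem ext_of_Iio {v w : K n} (hval : v.val = w.val) (hlt : Set.Iio v = Set.Iio w) : v = w := by
  have key : ∀ {v w : K n}, Set.Iio v = Set.Iio w → ptBelow n v.1 ⊆ ptBelow n w.1 := by
    intro v w hlt x hx
    obtain ⟨d, hd⟩ := v.2
    have h : (⟨x, d, ptBelow_mem_stage hd hx⟩ : K n) ∈ Set.Iio v := lt_iff.2 hx
    rw [hlt] at h
    exact lt_iff.1 h
  have hb : ptBelow n v.1 = ptBelow n w.1 := (key hlt).antisymm (key hlt.symm)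
  obtain ⟨dv, hv⟩ := v.2
  obtain ⟨dw, hw⟩ := w.2
  apply Subtype.ext
  rw [eq_wPt_of_mem_stage hv, eq_wPt_of_mem_stage hw, hb]
  exact congrArg (fun β => wPt β (ptBelow n w.1)) hval

/-- A point with a unique lower cover has a smaller valuation than that cover. -/
theorem val_ne_of_Iio_eq_Iic {v w : K n} (h : Set.Iio w = Set.Iic v) : w.val ≠ v.val := by
  obtain ⟨d, hd⟩ := w.2
  obtain ⟨e, -, -, ha⟩ := exists_admissible hd
  have hvw : v < w := by
    have : v ∈ Set.Iic v := le_refl v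
    rwa [← h] at this
  refine ha.2.2.2 v.1 (ha.1 _ (lt_iff.1 hvw)) fun x => ⟨fun hx => ⟨ha.1 x hx, ?_⟩, fun hx => ?_⟩
  · have : (⟨x, e, ha.1 x hx⟩ : K n) ∈ Set.Iio w := lt_iff.2 hx
    rw [h] at this
    exact this
  · have : (⟨x, e, hx.1⟩ : K n) ∈ Set.Iic v := hx.2
    rw [← h] at this
    exact lt_iff.1 this

theorem stage_mono : Monotone (stage n) := monotone_nat_of_le_succ (stage_subset_succ n)

/-- The generic model contains every point it could contain: a finite decreasing set `Y` and a
valuation `β` that is contained in those of `Y` come from a point, unless `Y` is already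
generated by a point of valuation `β`. -/
theorem exists_Iio_eq {Y : Set (K n)} (hfin : Y.Finite) (hlow : IsLowerSet Y)
    {β : Finset (Fin n)} (hβ : ∀ y ∈ Y, β ⊆ y.val) (h : ∀ v : K n, Set.Iic v = Y → v.val ≠ β) :
    ∃ w : K n, w.val = β ∧ Set.Iio w = Y := by
  classical
  obtain ⟨Z, hZmem⟩ : ∃ Z : Finset ℕ, ∀ x, x ∈ Z ↔ ∃ u ∈ Y, u.1 = x :=
    ⟨(hfin.image fun v : K n => v.1).toFinset, fun x => by simp [Set.mem_image]⟩
  have hZ : ∀ v : K n, v.1 ∈ Z ↔ v ∈ Y := fun v =>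
    (hZmem v.1).trans ⟨fun ⟨u, hu, e⟩ => (Subtype.ext e : u = v) ▸ hu, fun hv => ⟨v, hv, rfl⟩⟩
  have hZK : ∀ x ∈ Z, ∃ hx : ∃ d, x ∈ stage n d, (⟨x, hx⟩ : K n) ∈ Y := by
    intro x hx
    obtain ⟨u, hu, rfl⟩ := (hZmem x).1 hx
    exact ⟨u.2, hu⟩
  have hbound : ∃ d, ∀ x ∈ Z, x ∈ stage n d := by
    choose! g hg using fun x (hx : x ∈ Z) => (hZK x hx).1
    refine ⟨Z.sup g, fun x hx => ?_⟩
    have hle : g x ≤ Z.sup g := Finset.le_sup hx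
    exact stage_mono hle (hg x hx)
  have hadm : ∀ d, (∀ x ∈ Z, x ∈ stage n d) → Admissible (stage n d) β Z := by
    intro d hd
    refine ⟨hd, fun y hy x hx hxy => ?_, fun y hy => hβ ⟨y, (hZK y hy).1⟩ (hZK y hy).2, fun v hv hvZ e => ?_⟩
    · obtain ⟨hyK, hyY⟩ := hZK y hy
      exact (hZ ⟨x, d, hx⟩).2 (hlow (show @LE.le (K n) _ ⟨x, d, hx⟩ ⟨y, hyK⟩ from hxy) hyY)
    · refine h ⟨v, d, hv⟩ (Set.ext fun x => ?_) e.symm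
      rw [← hZ, hvZ]
      refine ⟨fun hx => ⟨?_, hx⟩, fun hx => hx.2⟩
      rcases hx with hx | hx
      · exact ptBelow_mem_stage hv hx
      · exact (show x.1 = v from hx) ▸ hv
  have hmem : wPt β Z ∈ stage n (Nat.find hbound + 1) := by
    have hspec := Nat.find_spec hbound
    rcases hd : Nat.find hbound with _ | d
    · rw [hd] at hspec
      exact ⟨β, Z, rfl, hadm 0 hspec⟩
    · rw [hd] at hspec
      exact Or.inr ⟨β, Z, rfl, hadm _ hspec, Nat.find_min hbound (by omega)⟩
  obtain ⟨w, hw⟩ : ∃ w : K n, w.1 = wPt β Z := ⟨⟨wPt β Z, _, hmem⟩, rfl⟩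
  refine ⟨w, by rw [val, hw, ptVal_wPt], Set.ext fun x => ?_⟩
  rw [Set.mem_Iio, lt_iff, ← hZ, hw, ptBelow_wPt]

end K

/-! ### The universal property of the generic model -/

section Universal

variable {n : ℕ} {W : Type*} [PartialOrder W]

theorem wellFounded_lt_of_finite_Iic (hfin : ∀ w : W, (Set.Iic w).Finite) :
    WellFounded (fun v w : W => v < w) :=
  (measure fun w : W => (Set.Iic w).ncard).wf.mono fun _ w h =>
    Set.ncard_lt_ncard (Set.Iic_ssubset_Iic.2 h) (hfin w)

/-- Every poset with finite principal ideals that carries an antitone family of valuations has a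
valuation preserving p-morphism to the generic model: the image of the principal ideal of a point
is the principal ideal of its image. -/
theorem exists_pMorphism (hfin : ∀ w : W, (Set.Iic w).Finite) (c : W → Finset (Fin n))
    (hc : Antitone c) :
    ∃ f : W → K n, (∀ w, (f w).val = c w) ∧ ∀ w, f '' Set.Iic w = Set.Iic (f w) := by
  have hwf := wellFounded_lt_of_finite_Iic hfin
  -- The value at `w` is chosen by recursion, given the values below `w`.
  have hstep : ∀ (Y : Set (K n)) (β : Finset (Fin n)), ∃ k : K n,
      Y.Finite → IsLowerSet Y → (∀ y ∈ Y, β ⊆ y.val) → k.val = β ∧ insert k Y = Set.Iic k := by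
    intro Y β
    by_cases hY : Y.Finite ∧ IsLowerSet Y ∧ ∀ y ∈ Y, β ⊆ y.val
    · by_cases h : ∃ v : K n, Set.Iic v = Y ∧ v.val = β
      · obtain ⟨v, rfl, hv⟩ := h
        exact ⟨v, fun _ _ _ => ⟨hv, Set.insert_eq_of_mem (le_refl v)⟩⟩
      · obtain ⟨w, hw, hwY⟩ := K.exists_Iio_eq hY.1 hY.2.1 hY.2.2
          (fun v hv e => h ⟨v, hv, e⟩)
        exact ⟨w, fun _ _ _ => ⟨hw, by rw [← hwY, Set.Iio_insert]⟩⟩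
    -- Outside the hypotheses any value will do, but the model has to be nonempty.
    · obtain ⟨w, -⟩ := K.exists_Iio_eq (n := n) (β := Finset.univ) Set.finite_empty
        isLowerSet_empty (by simp)
        (fun v hv => absurd (hv ▸ (le_refl v : v ∈ Set.Iic v)) (Set.notMem_empty v))
      exact ⟨w, fun h1 h2 h3 => (hY ⟨h1, h2, h3⟩).elim⟩
  choose k hk using hstep
  let f : W → K n := hwf.fix fun w g => k {y | ∃ v, ∃ h : v < w, g v h = y} (c w)
  have hf : ∀ w, f w = k (f '' Set.Iio w) (c w) := by
    intro w
    have h : f w = k {y | ∃ v, ∃ _ : v < w, f v = y} (c w) := hwf.fix_eq _ w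
    rw [h]
    congr 1
    ext y
    simp [Set.mem_image]
  have main : ∀ w, (f w).val = c w ∧ f '' Set.Iic w = Set.Iic (f w) := by
    intro w
    induction w using hwf.induction with
    | _ w ih =>
      have key := hk (f '' Set.Iio w) (c w) (((hfin w).subset Set.Iio_subset_Iic_self).image f)
        (by
          rintro _ y hy ⟨v, hv, rfl⟩
          have hy' : y ∈ Set.Iic (f v) := hy
          rw [← (ih v hv).2] at hy'
          obtain ⟨u, hu, rfl⟩ := hy'
          exact ⟨u, lt_of_le_of_lt hu hv, rfl⟩)
        (by
          rintro _ ⟨v, hv, rfl⟩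
          rw [(ih v hv).1]
          exact hc (le_of_lt hv))
      rw [← hf] at key
      refine ⟨key.1, ?_⟩
      rw [← Set.Iio_insert, Set.image_insert_eq]
      exact key.2
  exact ⟨f, fun w => (main w).1, fun w => (main w).2⟩

/-- A p-morphism to the generic model is injective as soon as the valuations separate points of
its domain in the way they do in the generic model. -/
theorem pMorphism_injective (hfin : ∀ w : W, (Set.Iic w).Finite) {f : W → K n}
    (hf : ∀ w, f '' Set.Iic w = Set.Iic (f w))
    (h₁ : ∀ v w, Set.Iio v = Set.Iio w → (f v).val = (f w).val → v = w)
    (h₂ : ∀ v w, Set.Iio w = Set.Iic v → (f w).val ≠ (f v).val) : Function.Injective f := by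
  have hmono : ∀ {v w : W}, v ≤ w → f v ≤ f w := fun {v w} h => by
    have : f v ∈ f '' Set.Iic w := ⟨v, h, rfl⟩
    rwa [hf] at this
  have hlt : ∀ {v w : W}, v < w → (Set.Iic v).ncard < (Set.Iic w).ncard := fun {v w} h =>
    Set.ncard_lt_ncard (Set.Iic_ssubset_Iic.2 h) (hfin w)
  suffices H : ∀ (m : ℕ) (v w : W), (Set.Iic v).ncard + (Set.Iic w).ncard = m → f v = f w →
      v = w from fun v w h => H _ v w rfl h
  intro m
  induction m using Nat.strong_induction_on with
  | _ m ih =>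
    -- Points strictly below one of the two points lie below the other, by induction.
    have below : ∀ v w : W, (Set.Iic v).ncard + (Set.Iic w).ncard = m → f v = f w →
        ∀ u < v, u ≤ w := by
      intro v w hm h u hu
      have hu' : f u ∈ Set.Iic (f w) := h ▸ hmono hu.le
      rw [← hf] at hu'
      obtain ⟨t, ht, e⟩ := hu'
      have h1 := hlt hu
      have h2 : (Set.Iic t).ncard ≤ (Set.Iic w).ncard :=
        Set.ncard_le_ncard (Set.Iic_subset_Iic.2 ht) (hfin w)
      rw [ih _ (by omega) u t rfl e.symm]
      exact ht
    intro v w hm h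
    have hvw := below v w hm h
    have hwv := below w v (by omega) h.symm
    by_contra hne
    by_cases h1 : v < w
    · exact h₂ v w (Set.ext fun u => ⟨hwv u, fun hu => lt_of_le_of_lt hu h1⟩)
        (congrArg K.val h.symm)
    by_cases h2 : w < v
    · exact h₂ w v (Set.ext fun u => ⟨hvw u, fun hu => lt_of_le_of_lt hu h2⟩)
        (congrArg K.val h)
    refine hne (h₁ v w (Set.ext fun u => ⟨fun hu => ?_, fun hu => ?_⟩) (congrArg K.val h))
    · exact lt_of_le_of_ne (hvw u hu) fun e => h2 (e ▸ hu)
    · exact lt_of_le_of_ne (hwv u hu) fun e => h1 (e ▸ hu)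

end Universal

/-- Finitely many points have at most `m` points below or equal to them, since a point is determined by its
valuation and the points strictly below it. -/
theorem K.finite_setOf_ncard_le {n : ℕ} (m : ℕ) : {w : K n | (Set.Iic w).ncard ≤ m}.Finite := by
  induction m with
  | zero =>
    refine Set.finite_empty.subset fun w hw => ?_
    have h0 : (Set.Iic w).ncard = 0 := Nat.le_zero.1 hw
    rw [Set.ncard_eq_zero (K.finite_Iic w)] at h0
    exact h0 ▸ (le_refl w : w ∈ Set.Iic w)
  | succ m ih =>
    refine Set.Finite.of_injOn (f := fun w : K n => (w.val, Set.Iio w))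
      (t := Set.univ ×ˢ {s | s ⊆ {w : K n | (Set.Iic w).ncard ≤ m}}) ?_ ?_
      (Set.finite_univ.prod ih.finite_subsets)
    · intro w hw
      refine ⟨trivial, fun v hv => ?_⟩
      have h := Set.ncard_lt_ncard (Set.Iic_ssubset_Iic.2 hv) (K.finite_Iic w)
      have hw' : (Set.Iic w).ncard ≤ m + 1 := hw
      exact Nat.lt_succ_iff.1 (h.trans_le hw')
    · intro v _ w _ h
      exact K.ext_of_Iio (Prod.ext_iff.1 h).1 (Prod.ext_iff.1 h).2

/-- An injective p-morphism from the generic model to itself is an automorphism of its order: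
it permutes each of the finite sets of points of bounded height. -/
theorem exists_orderIso_of_pMorphism {n : ℕ} {f : K n → K n}
    (hf : ∀ w, f '' Set.Iic w = Set.Iic (f w)) (hinj : Function.Injective f) :
    ∃ e : K n ≃o K n, ⇑e = f := by
  have hcard : ∀ w, (Set.Iic (f w)).ncard = (Set.Iic w).ncard := fun w => by
    rw [← hf, Set.ncard_image_of_injective _ hinj]
  have hsurj : Function.Surjective f := by
    intro w
    have hS := K.finite_setOf_ncard_le (n := n) (Set.Iic w).ncard
    have hmaps : Set.MapsTo f {v : K n | (Set.Iic v).ncard ≤ (Set.Iic w).ncard}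
        {v : K n | (Set.Iic v).ncard ≤ (Set.Iic w).ncard} := fun v hv => by
      change (Set.Iic (f v)).ncard ≤ _
      rw [hcard]
      exact hv
    have himage := Set.eq_of_subset_of_ncard_le hmaps.image_subset
      (Set.ncard_image_of_injective _ hinj).ge hS
    have hw : w ∈ {v : K n | (Set.Iic v).ncard ≤ (Set.Iic w).ncard} := le_refl (Set.Iic w).ncard
    rw [← himage] at hw
    obtain ⟨v, -, h⟩ := hw
    exact ⟨v, h⟩
  refine ⟨⟨Equiv.ofBijective f ⟨hinj, hsurj⟩, fun {v w} => ?_⟩, rfl⟩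
  change f v ≤ f w ↔ v ≤ w
  rw [← Set.mem_Iic, ← hf, hinj.mem_set_image, Set.mem_Iic]

/-! ### Completeness of the generic model -/

/-- The set of subformulas of a formula. -/
def Fml.subformulas {n : ℕ} : Fml n → Set (Fml n)
  | .var i => {.var i}
  | .bot => {.bot}
  | .and φ ψ => insert (.and φ ψ) (φ.subformulas ∪ ψ.subformulas)
  | .or φ ψ => insert (.or φ ψ) (φ.subformulas ∪ ψ.subformulas)
  | .imp φ ψ => insert (.imp φ ψ) (φ.subformulas ∪ ψ.subformulas)

theorem Fml.finite_subformulas {n : ℕ} (φ : Fml n) : φ.subformulas.Finite := by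
  induction φ with
  | var i => exact Set.finite_singleton _
  | bot => exact Set.finite_singleton _
  | and φ ψ h h' => exact (h.union h').insert _
  | or φ ψ h h' => exact (h.union h').insert _
  | imp φ ψ h h' => exact (h.union h').insert _

theorem Fml.mem_subformulas_self {n : ℕ} (φ : Fml n) : φ ∈ φ.subformulas := by
  cases φ <;> simp [Fml.subformulas]

/-- The semantic clause of implication for prime ideals: the failure of `a ⇨ b` is witnessed by
a smaller prime ideal. -/
theorem exists_isPrime_of_himp_mem {α : Type*} [HeytingAlgebra α] {J : Order.Ideal α}
    (hJ : J.IsPrime) {a b : α} (h : a ⇨ b ∈ J) :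
    ∃ J' : Order.Ideal α, J'.IsPrime ∧ J' ≤ J ∧ a ∉ J' ∧ b ∈ J' := by
  have htop : ⊤ ∉ J := Order.Ideal.isProper_iff_top_notMem.1 hJ.toIsProper
  have hF : Order.IsPFilter {x : α | a ⇨ x ∉ J} := by
    refine Order.IsPFilter.of_def ⟨⊤, by simpa using htop⟩ ?_ ?_
    · intro x hx y hy
      refine ⟨x ⊓ y, fun hxy => ?_, inf_le_left, inf_le_right⟩
      rw [himp_inf_distrib] at hxy
      exact (hJ.mem_or_mem hxy).elim hx hy
    · intro x y hxy hx hy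
      exact hx (J.lower (himp_le_himp_left hxy) hy)
  obtain ⟨J', hJ', hle, hdisj⟩ := DistribLattice.prime_ideal_of_disjoint_filter_ideal
    (F := hF.toPFilter) (I := Order.Ideal.principal b) (by
      rw [Set.disjoint_left]
      intro x hx hxb
      exact hx (J.lower (himp_le_himp_left hxb) h))
  rw [Set.disjoint_left] at hdisj
  refine ⟨J', hJ', fun x hx => ?_, fun ha => ?_, hle (le_refl b)⟩
  · by_contra hxJ
    exact hdisj (show a ⇨ x ∉ J from fun h' => hxJ (J.lower le_himp h')) hx
  · exact hdisj (show a ⇨ a ∉ J by simpa using htop) ha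

/-- Completeness of the generic model. A prime ideal that separates `φ` from `ψ` is a point of the
canonical Kripke model; its quotient by the subformulas of `φ` and `ψ` is finite, and is mapped
to the generic model by the universal property. -/
theorem Fr.mk_le_mk_of_forces {n : ℕ} {φ ψ : Fml n} (h : ∀ w : K n, Forces w φ → Forces w ψ) :
    Fr.mk φ ≤ Fr.mk ψ := by
  classical
  by_contra hle
  let S : Set (Fml n) := φ.subformulas ∪ ψ.subformulas
  have hS : S.Finite := φ.finite_subformulas.union ψ.finite_subformulas
  -- The order is reversed: truth is inherited downwards, so larger theories are lower points.
  let W : Type := {T : (Set (Fml n))ᵒᵈ //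
    ∃ J : Order.Ideal (Fr n), J.IsPrime ∧ T = OrderDual.toDual {χ ∈ S | Fr.mk χ ∉ J}}
  have hW : Finite W := by
    refine Set.Finite.to_subtype (s := {T : (Set (Fml n))ᵒᵈ |
      ∃ J : Order.Ideal (Fr n), J.IsPrime ∧ T = OrderDual.toDual {χ ∈ S | Fr.mk χ ∉ J}})
      (hS.finite_subsets.subset ?_)
    rintro _ ⟨J, -, rfl⟩
    exact Set.sep_subset _ _
  let c : W → Finset (Fin n) := fun T => {i | Fml.var i ∈ OrderDual.ofDual T.1}
  obtain ⟨f, hval, hf⟩ := exists_pMorphism (fun w : W => Set.toFinite (Set.Iic w)) c (by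
    intro T T' hTT' i hi
    simp only [c, Finset.mem_filter, Finset.mem_univ, true_and] at hi ⊢
    exact hTT' hi)
  have truth : ∀ χ : Fml n, χ.subformulas ⊆ S →
      ∀ T : W, Forces (f T) χ ↔ χ ∈ OrderDual.ofDual T.1 := by
    intro χ
    induction χ with
    | var i =>
      intro _ T
      change i ∈ (f T).val ↔ _
      rw [hval]
      simp [c]
    | bot =>
      rintro _ ⟨_, J, hJ, rfl⟩
      exact ⟨False.elim, fun hb => hb.2 J.bot_mem⟩
    | and χ₁ χ₂ ih₁ ih₂ =>
      intro hsub T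
      have hs := Set.insert_subset_iff.1 hsub
      have h₁ := Set.subset_union_left.trans hs.2
      have h₂ := Set.subset_union_right.trans hs.2
      change Forces (f T) χ₁ ∧ Forces (f T) χ₂ ↔ _
      rw [ih₁ h₁, ih₂ h₂]
      obtain ⟨_, J, hJ, rfl⟩ := T
      refine ⟨fun hT => ⟨hs.1, fun hm => ?_⟩, fun hT => ?_⟩
      · exact (hJ.mem_or_mem (x := Fr.mk χ₁) (y := Fr.mk χ₂) hm).elim hT.1.2 hT.2.2
      · exact ⟨⟨h₁ χ₁.mem_subformulas_self, fun hm =>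
            hT.2 (J.lower (inf_le_left : Fr.mk χ₁ ⊓ Fr.mk χ₂ ≤ _) hm)⟩,
          ⟨h₂ χ₂.mem_subformulas_self, fun hm =>
            hT.2 (J.lower (inf_le_right : Fr.mk χ₁ ⊓ Fr.mk χ₂ ≤ _) hm)⟩⟩
    | or χ₁ χ₂ ih₁ ih₂ =>
      intro hsub T
      have hs := Set.insert_subset_iff.1 hsub
      have h₁ := Set.subset_union_left.trans hs.2
      have h₂ := Set.subset_union_right.trans hs.2
      change Forces (f T) χ₁ ∨ Forces (f T) χ₂ ↔ _
      rw [ih₁ h₁, ih₂ h₂]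
      obtain ⟨_, J, hJ, rfl⟩ := T
      refine ⟨fun hT => ⟨hs.1, fun hm => ?_⟩, fun hT => ?_⟩
      · exact hT.elim
          (fun hT => hT.2 (J.lower (le_sup_left : _ ≤ Fr.mk χ₁ ⊔ Fr.mk χ₂) hm))
          (fun hT => hT.2 (J.lower (le_sup_right : _ ≤ Fr.mk χ₁ ⊔ Fr.mk χ₂) hm))
      · by_contra hno
        rw [not_or] at hno
        have hm₁ : Fr.mk χ₁ ∈ J := by
          by_contra hm
          exact hno.1 ⟨h₁ χ₁.mem_subformulas_self, hm⟩
        have hm₂ : Fr.mk χ₂ ∈ J := by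
          by_contra hm
          exact hno.2 ⟨h₂ χ₂.mem_subformulas_self, hm⟩
        exact hT.2 (Order.Ideal.sup_mem hm₁ hm₂)
    | imp χ₁ χ₂ ih₁ ih₂ =>
      intro hsub T
      have hs := Set.insert_subset_iff.1 hsub
      have h₁ := Set.subset_union_left.trans hs.2
      have h₂ := Set.subset_union_right.trans hs.2
      have hforces : Forces (f T) (.imp χ₁ χ₂) ↔
          ∀ T' ≤ T, χ₁ ∈ OrderDual.ofDual T'.1 → χ₂ ∈ OrderDual.ofDual T'.1 := by
        change (∀ v ∈ Set.Iic (f T), Forces v χ₁ → Forces v χ₂) ↔ _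
        rw [← hf, Set.forall_mem_image]
        exact forall₂_congr fun T' _ => by rw [ih₁ h₁, ih₂ h₂]
      rw [hforces]
      obtain ⟨_, J, hJ, rfl⟩ := T
      refine ⟨fun hT => ⟨hs.1, fun hm => ?_⟩, fun hT T' hT' hχ => ?_⟩
      · obtain ⟨J', hJ', hle, ha, hb⟩ :=
          exists_isPrime_of_himp_mem (a := Fr.mk χ₁) (b := Fr.mk χ₂) hJ hm
        exact (hT ⟨_, J', hJ', rfl⟩ (fun χ hχ => ⟨hχ.1, fun h => hχ.2 (hle h)⟩)
          ⟨h₁ χ₁.mem_subformulas_self, ha⟩).2 hb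
      · have hT'' : Fml.imp χ₁ χ₂ ∈ OrderDual.ofDual T'.1 := hT' hT
        obtain ⟨_, J', hJ', rfl⟩ := T'
        refine ⟨h₂ χ₂.mem_subformulas_self, fun hm => ?_⟩
        rcases hJ'.mem_or_mem (x := Fr.mk χ₁ ⇨ Fr.mk χ₂) (y := Fr.mk χ₁)
          (J'.lower himp_inf_le hm) with h' | h'
        · exact hT''.2 h'
        · exact hχ.2 h'
  obtain ⟨J, hJ, hψ, hφ⟩ := DistribLattice.prime_ideal_of_disjoint_filter_ideal
    (F := Order.PFilter.principal (Fr.mk φ)) (I := Order.Ideal.principal (Fr.mk ψ)) (by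
      rw [Set.disjoint_left]
      exact fun x hx hx' => hle (le_trans hx hx'))
  let T : W := ⟨_, J, hJ, rfl⟩
  have h1 := (truth φ Set.subset_union_left T).2
    ⟨Or.inl φ.mem_subformulas_self, fun hm => Set.disjoint_left.1 hφ (le_refl (Fr.mk φ)) hm⟩
  have h2 := (truth ψ Set.subset_union_right T).1 (h _ h1)
  exact h2.2 (hψ (le_refl (Fr.mk ψ)))

theorem canonicalMap_le_iff {n : ℕ} {a b : Fr n} :
    canonicalMap n a ≤ canonicalMap n b ↔ a ≤ b := by
  induction a using Quotient.inductionOn with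
  | _ φ =>
  induction b using Quotient.inductionOn with
  | _ ψ =>
  exact ⟨fun h => Fr.mk_le_mk_of_forces fun w hw => h hw,
    fun h w hw => forces_of_ipc (show IPC (.imp φ ψ) from h) w w le_rfl hw⟩

theorem canonicalMap_injective (n : ℕ) : Function.Injective (canonicalMap n) := fun _ _ h =>
  le_antisymm (canonicalMap_le_iff.1 h.le) (canonicalMap_le_iff.1 h.ge)

/-! ### Principal decreasing sets are defined by formulas -/

theorem exists_forces_iff_exists {n : ℕ} {ι : Type*} (s : Finset ι) (g : ι → Fml n) :
    ∃ φ : Fml n, ∀ u : K n, Forces u φ ↔ ∃ i ∈ s, Forces u (g i) := by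
  classical
  induction s using Finset.induction_on with
  | empty => exact ⟨.bot, fun u => by simp [Forces]⟩
  | insert i s _ ih =>
    obtain ⟨φ, hφ⟩ := ih
    refine ⟨.or (g i) φ, fun u => ?_⟩
    rw [Finset.exists_mem_insert, ← hφ]
    exact Iff.rfl

theorem exists_forces_iff_forall {n : ℕ} {ι : Type*} (s : Finset ι) (g : ι → Fml n) :
    ∃ φ : Fml n, ∀ u : K n, Forces u φ ↔ ∀ i ∈ s, Forces u (g i) := by
  classical
  induction s using Finset.induction_on with
  | empty => exact ⟨.imp .bot .bot, fun u => by simp [Forces]⟩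
  | insert i s _ ih =>
    obtain ⟨φ, hφ⟩ := ih
    refine ⟨.and (g i) φ, fun u => ?_⟩
    rw [Finset.forall_mem_insert, ← hφ]
    exact Iff.rfl

/-- The decreasing set generated by a point is the truth set of a formula. Given formulas `φ_v`
for the points `v < w`, let `ψ_v` be `φ_v → ⋁_{t < v} φ_t`, which holds at the points that are not
above `v`. Then `w` is described by
`⋀_{i ∈ val w} P_i ∧ (⋁_{i ∉ val w} P_i ∨ ⋁_{v < w} ψ_v → ⋁_{v < w} φ_v)`. -/
theorem exists_forces_iff_le {n : ℕ} (w : K n) :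
    ∃ φ : Fml n, ∀ u : K n, Forces u φ ↔ u ≤ w := by
  classical
  have : Nonempty (Fml n) := ⟨.bot⟩
  have hwf := wellFounded_lt_of_finite_Iic (W := K n) K.finite_Iic
  induction w using hwf.induction with
  | _ w ih =>
    choose! g hg using ih
    have hψ : ∀ v < w, ∃ ψ : Fml n, ∀ u : K n, Forces u ψ ↔ ¬ v ≤ u := by
      intro v hv
      obtain ⟨χ, hχ⟩ := exists_forces_iff_exists (K.finite_Iio v).toFinset g
      refine ⟨.imp (g v) χ, fun u => ?_⟩
      have hχ' : ∀ u, Forces u χ ↔ u < v := by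
        intro u
        rw [hχ]
        constructor
        · rintro ⟨t, ht, hut⟩
          have ht' : t < v := by simpa using ht
          exact lt_of_le_of_lt ((hg t (ht'.trans hv) u).1 hut) ht'
        · exact fun hu => ⟨u, by simpa using hu, (hg u (hu.trans hv) u).2 le_rfl⟩
      change (∀ t ≤ u, Forces t (g v) → Forces t χ) ↔ _
      simp only [hg v hv, hχ']
      exact ⟨fun h hvu => lt_irrefl v (h v hvu le_rfl),
        fun h t htu htv => lt_of_le_of_ne htv fun e => h (e ▸ htu)⟩
    choose! ψ hψ using hψ
    obtain ⟨α, hα⟩ := exists_forces_iff_forall w.val Fml.var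
    obtain ⟨γ, hγ⟩ := exists_forces_iff_exists w.valᶜ Fml.var
    obtain ⟨δ, hδ⟩ := exists_forces_iff_exists (K.finite_Iio w).toFinset ψ
    obtain ⟨ε, hε⟩ := exists_forces_iff_exists (K.finite_Iio w).toFinset g
    have hα' : ∀ u, Forces u α ↔ w.val ⊆ u.val := hα
    have hγδ : ∀ u, ¬ Forces u (.or γ δ) ↔ u.val ⊆ w.val ∧ ∀ v < w, v ≤ u := by
      intro u
      change ¬ (Forces u γ ∨ Forces u δ) ↔ _
      rw [not_or, hγ, hδ]
      refine and_congr ⟨fun h i hi => ?_, ?_⟩ ⟨fun h v hv => ?_, ?_⟩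
      · by_contra hiw
        exact h ⟨i, Finset.mem_compl.2 hiw, hi⟩
      · rintro h ⟨i, hi, hiu⟩
        exact Finset.mem_compl.1 hi (h hiu)
      · by_contra hvu
        exact h ⟨v, by simpa using hv, (hψ v hv u).2 hvu⟩
      · rintro h ⟨v, hv, hvu⟩
        have hv' : v < w := by simpa using hv
        exact (hψ v hv' u).1 hvu (h v hv')
    have hε' : ∀ u, Forces u ε ↔ u < w := by
      intro u
      rw [hε]
      constructor
      · rintro ⟨t, ht, hut⟩
        have ht' : t < w := by simpa using ht
        exact lt_of_le_of_lt ((hg t ht' u).1 hut) ht'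
      · exact fun hu => ⟨u, by simpa using hu, (hg u hu u).2 le_rfl⟩
    refine ⟨.and α (.imp (.or γ δ) ε), fun u => ⟨fun hu => ?_, fun hu => ⟨?_, ?_⟩⟩⟩
    · -- A minimal counterexample `u` has all its proper lower bounds below `w`, refutes the
      -- premise, and so agrees with `w` in valuation.
      induction u using hwf.induction with
      | _ u ihu =>
        by_contra huw
        have hlow : ∀ t < u, t ≤ w := fun t ht => ihu t ht (hu.mono ht.le)
        have hprem : ¬ Forces u (.or γ δ) := fun h =>
          huw ((hε' u).1 (hu.2 u le_rfl h)).le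
        obtain ⟨hv, hb⟩ := (hγδ u).1 hprem
        have hval : u.val = w.val := hv.antisymm ((hα' u).1 hu.1)
        have hb' : ∀ v < w, v < u := fun v hv =>
          lt_of_le_of_ne (hb v hv) fun e => huw (e ▸ hv.le)
        by_cases hwu : w < u
        · exact K.val_ne_of_Iio_eq_Iic
            (Set.ext fun t => ⟨hlow t, fun ht => lt_of_le_of_lt ht hwu⟩) hval
        · exact huw (K.ext_of_Iio hval (Set.ext fun t => ⟨fun ht =>
            lt_of_le_of_ne (hlow t ht) fun e => hwu (e ▸ ht), hb' t⟩)).le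
    · exact (hα' u).2 (K.val_anti hu)
    · intro t ht h
      refine (hε' t).2 (lt_of_le_of_ne (ht.trans hu) ?_)
      rintro rfl
      exact (hγδ t).2 ⟨Finset.Subset.refl _, fun v hv => hv.le⟩ h

theorem exists_canonicalMap_eq_Iic {n : ℕ} (w : K n) :
    ∃ a : Fr n, canonicalMap n a = LowerSet.Iic w := by
  obtain ⟨φ, hφ⟩ := exists_forces_iff_le w
  exact ⟨Fr.mk φ, SetLike.ext hφ⟩

/-! ### A first-order property of the generators -/

/-- The symbol `⊓` of the language of Heyting algebras. -/
def LHA.meet : LHA.Functions 2 := HeytingFunc.meet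

/-- The symbol `⊔` of the language of Heyting algebras. -/
def LHA.join : LHA.Functions 2 := HeytingFunc.join

/-- The symbol `→` of the language of Heyting algebras. -/
def LHA.imp : LHA.Functions 2 := HeytingFunc.imp

/-- A tuple `x` in a Heyting algebra separates the completely join irreducible elements `p`, which
are the ones with a largest element strictly below `p`, if no two of them that lie below the same
entries of `x` have the same lower cover, and none lies below the same entries of `x` as its lower
cover when that is such an element too. The two conditions are the cases `z = y` and `q = y`. -/
def SeparatesIrreducibles {ι H : Type*} [HeytingAlgebra H] (x : ι → H) : Prop :=
  ∀ p q y z : H, IsGreatest (Set.Iio p) y → IsGreatest (Set.Iio q) z → (z = y ∨ q = y) →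
    (∀ i, p ≤ x i ↔ q ≤ x i) → p = q

open FirstOrder FirstOrder.Language in
theorem exists_formula_separatesIrreducibles (ι : Type) [Finite ι] :
    ∃ Γ : LHA.Formula ι, ∀ (H : Type) [HeytingAlgebra H] (x : ι → H),
      Γ.Realize x ↔ SeparatesIrreducibles x := by
  have hle : ∀ {α : Type} (s t : LHA.Term α), ∃ θ : LHA.Formula α,
      ∀ (H : Type) [HeytingAlgebra H] (x : α → H), θ.Realize x ↔ s.realize x ≤ t.realize x := by
    intro α s t
    refine ⟨(Functions.apply₂ LHA.meet s t).equal s, fun H _ x => ?_⟩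
    rw [Formula.realize_equal, Term.realize_functions_apply₂]
    exact inf_eq_left
  have hgreatest : ∀ {α : Type} (p y : α), ∃ θ : LHA.Formula α,
      ∀ (H : Type) [HeytingAlgebra H] (x : α → H),
        θ.Realize x ↔ IsGreatest (Set.Iio (x p)) (x y) := by
    intro α p y
    have hlt : ∀ {β : Type} (a b : β), ∃ θ : LHA.Formula β,
        ∀ (H : Type) [HeytingAlgebra H] (x : β → H), θ.Realize x ↔ x a < x b := by
      intro β a b
      obtain ⟨θ₁, h₁⟩ := hle (Term.var (L := LHA) a) (Term.var b)
      obtain ⟨θ₂, h₂⟩ := hle (Term.var (L := LHA) b) (Term.var a)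
      refine ⟨θ₁ ⊓ ∼θ₂, fun H _ x => ?_⟩
      rw [Formula.realize_inf, Formula.realize_not, h₁, h₂, lt_iff_le_not_ge]
      rfl
    obtain ⟨θ₁, h₁⟩ := hlt y p
    obtain ⟨θ₂, h₂⟩ := hlt (β := α ⊕ Unit) (Sum.inr ()) (Sum.inl p)
    obtain ⟨θ₃, h₃⟩ := hle (α := α ⊕ Unit) (Term.var (Sum.inr ())) (Term.var (Sum.inl y))
    refine ⟨θ₁ ⊓ (θ₂.imp θ₃).iAlls Unit, fun H _ x => ?_⟩
    rw [Formula.realize_inf, Formula.realize_iAlls, h₁]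
    refine and_congr Iff.rfl ⟨fun h z hz => ?_, fun h z => ?_⟩
    · have := h fun _ => z
      rw [Formula.realize_imp, h₂, h₃] at this
      exact this hz
    · rw [Formula.realize_imp, h₂, h₃]
      exact fun hz => h hz
  let v : Fin 4 → ι ⊕ Fin 4 := Sum.inr
  obtain ⟨θ₁, h₁⟩ := hgreatest (v 0) (v 2)
  obtain ⟨θ₂, h₂⟩ := hgreatest (v 1) (v 3)
  choose θ₃ h₃ using fun i : ι =>
    hle (α := ι ⊕ Fin 4) (Term.var (v 0)) (Term.var (Sum.inl i))
  choose θ₄ h₄ using fun i : ι =>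
    hle (α := ι ⊕ Fin 4) (Term.var (v 1)) (Term.var (Sum.inl i))
  let E : Fin 4 → Fin 4 → LHA.Formula (ι ⊕ Fin 4) := fun a b =>
    (Term.var (v a)).equal (Term.var (v b))
  refine ⟨(θ₁.imp <| θ₂.imp <| (E 3 2 ⊔ E 1 2).imp <|
    (Formula.iInf fun i => (θ₃ i).iff (θ₄ i)).imp (E 0 1)).iAlls (Fin 4), fun H _ x => ?_⟩
  simp only [Formula.realize_iAlls, Formula.realize_imp, Formula.realize_sup,
    Formula.realize_iInf, Formula.realize_iff, E, Formula.realize_equal, h₁, h₂, h₃, h₄,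
    Term.realize_var, v, Sum.elim_inl, Sum.elim_inr]
  exact ⟨fun h p q y z => h ![p, q, y, z], fun h u => h (u 0) (u 1) (u 2) (u 3)⟩

theorem LowerSet.isGreatest_Iio_Iic {α : Type*} [PartialOrder α] (w : α) :
    IsGreatest (Set.Iio (LowerSet.Iic w)) (LowerSet.Iio w) := by
  have hle : LowerSet.Iio w ≤ LowerSet.Iic w := fun v (hv : v < w) => hv.le
  refine ⟨lt_of_le_not_ge hle fun h => lt_irrefl w (h (le_refl w)), fun s hs v hv => ?_⟩
  have hs' : s < LowerSet.Iic w := hs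
  refine lt_of_le_of_ne (hs'.le hv) ?_
  rintro rfl
  exact hs'.not_ge (LowerSet.Iic_le.2 hv)

/-- The completely join irreducible elements of the free Heyting algebra are the principal
decreasing sets. -/
theorem exists_eq_Iic_of_isGreatest {n : ℕ} {p y : Fr n} (h : IsGreatest (Set.Iio p) y) :
    ∃ w : K n, canonicalMap n p = LowerSet.Iic w ∧ canonicalMap n y = LowerSet.Iio w := by
  choose g hg using exists_canonicalMap_eq_Iic (n := n)
  have hmem : ∀ (w : K n) (a : Fr n), w ∈ canonicalMap n a ↔ g w ≤ a := fun w a => by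
    rw [← canonicalMap_le_iff, hg, LowerSet.Iic_le]
  have hw : ∃ w, g w = p := by
    by_contra! hne
    exact h.1.not_ge (canonicalMap_le_iff.1 fun w hw =>
      (hmem w y).2 (h.2 (lt_of_le_of_ne ((hmem w p).1 hw) (hne w))))
  obtain ⟨w, rfl⟩ := hw
  refine ⟨w, hg w, le_antisymm ?_ fun v hv => ?_⟩
  · refine (LowerSet.isGreatest_Iio_Iic w).2 ?_
    rw [← hg]
    exact lt_of_le_not_ge (canonicalMap_le_iff.2 h.1.le)
      fun h' => h.1.not_ge (canonicalMap_le_iff.1 h')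
  · have hvw : v < w := hv
    have hgvw : g v < g w := by
      refine lt_of_le_not_ge ?_ fun h' => ?_
      · rw [← hmem, hg]
        exact hvw.le
      · rw [← hmem, hg] at h'
        exact hvw.not_ge h'
    exact (hmem v y).2 (h.2 hgvw)

/-- The generators of the free Heyting algebra. -/
def Fr.gen {n : ℕ} (i : Fin n) : Fr n := Fr.mk (.var i)

theorem mem_canonicalMap_gen {n : ℕ} {i : Fin n} {w : K n} :
    w ∈ canonicalMap n (Fr.gen i) ↔ i ∈ w.val := Iff.rfl

theorem separatesIrreducibles_gen (n : ℕ) : SeparatesIrreducibles (Fr.gen : Fin n → Fr n) := by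
  intro p q y z hp hq hyz hx
  obtain ⟨w, hpw, hyw⟩ := exists_eq_Iic_of_isGreatest hp
  obtain ⟨v, hqv, hzv⟩ := exists_eq_Iic_of_isGreatest hq
  have hval : w.val = v.val := by
    ext i
    have := hx i
    rwa [← canonicalMap_le_iff, ← canonicalMap_le_iff, hpw, hqv, LowerSet.Iic_le,
      LowerSet.Iic_le] at this
  rcases hyz with rfl | rfl
  · have hwv : w = v := K.ext_of_Iio hval (congrArg SetLike.coe (hyw.symm.trans hzv))
    exact canonicalMap_injective n (hpw.trans ((congrArg _ hwv).trans hqv.symm))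
  · exact (K.val_ne_of_Iio_eq_Iic (congrArg SetLike.coe (hyw.symm.trans hqv)) hval).elim

/-- A tuple in the completion that separates the completely join irreducible elements is the
image of the generators under an automorphism. -/
theorem exists_orderIso_of_separatesIrreducibles {n : ℕ} {x : Fin n → Fco n}
    (hx : SeparatesIrreducibles x) :
    ∃ e : Fco n ≃o Fco n, ∀ i, e (x i) = canonicalMap n (Fr.gen i) := by
  classical
  let c : K n → Finset (Fin n) := fun w => {i | w ∈ x i}
  have hc : ∀ {w i}, i ∈ c w ↔ LowerSet.Iic w ≤ x i := fun {w i} => by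
    simp [c, LowerSet.Iic_le]
  obtain ⟨f, hval, hf⟩ := exists_pMorphism K.finite_Iic c fun v w hvw i hi =>
    hc.2 (le_trans (LowerSet.Iic_le.2 hvw) (hc.1 hi))
  have hinj : Function.Injective f := by
    refine pMorphism_injective K.finite_Iic hf (fun v w h e => ?_) fun v w h e => ?_
    all_goals
      rw [hval, hval] at e
      have hag : ∀ i, LowerSet.Iic w ≤ x i ↔ LowerSet.Iic v ≤ x i := fun i => by
        rw [← hc, ← hc, e]
    · exact (LowerSet.Iic_injective (hx _ _ _ _ (LowerSet.isGreatest_Iio_Iic w)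
        (LowerSet.isGreatest_Iio_Iic v) (Or.inl (LowerSet.ext h)) hag)).symm
    · have hvw : v < w := by
        have : v ∈ Set.Iic v := le_refl v
        rwa [← h] at this
      exact hvw.ne' (LowerSet.Iic_injective (hx _ _ _ _ (LowerSet.isGreatest_Iio_Iic w)
        (LowerSet.isGreatest_Iio_Iic v) (Or.inr (LowerSet.ext h.symm)) hag))
  obtain ⟨e, rfl⟩ := exists_orderIso_of_pMorphism hf hinj
  refine ⟨LowerSet.map e, fun i => SetLike.ext fun w => ?_⟩
  rw [mem_canonicalMap_gen]
  obtain ⟨v, rfl⟩ := e.surjective w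
  rw [hval, hc, LowerSet.Iic_le]
  exact e.injective.mem_set_image

/-! ### Elementary equivalence and the type of the generators -/

section Transfer

open FirstOrder FirstOrder.Language

/-- Order isomorphisms of Heyting algebras preserve first-order formulas. -/
theorem OrderIso.realize_formula_iff {H H' : Type*} [HeytingAlgebra H] [HeytingAlgebra H']
    (e : H ≃o H') {α : Type*} (θ : LHA.Formula α) (x : α → H) :
    θ.Realize (e ∘ x) ↔ θ.Realize x := by
  let E : LHA.Equiv H H' :=
    { e.toEquiv with
      map_fun' := by
        intro k s u
        cases s with
        | zero => exact map_bot e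
        | one => exact map_top e
        | meet => exact map_inf e _ _
        | join => exact map_sup e _ _
        | imp => exact map_himp e _ _
      map_rel' := fun r => r.elim }
  exact StrongHomClass.realize_formula E θ

/-- A propositional formula as a term in the language of Heyting algebras. -/
def Fml.toTerm {n : ℕ} : Fml n → LHA.Term (Fin n)
  | .var i => .var i
  | .bot => Constants.term (L := LHA) HeytingFunc.zero
  | .and φ ψ => Functions.apply₂ LHA.meet φ.toTerm ψ.toTerm
  | .or φ ψ => Functions.apply₂ LHA.join φ.toTerm ψ.toTerm
  | .imp φ ψ => Functions.apply₂ LHA.imp φ.toTerm ψ.toTerm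

theorem Fml.realize_toTerm_gen {n : ℕ} (φ : Fml n) :
    φ.toTerm.realize (Fr.gen : Fin n → Fr n) = Fr.mk φ := by
  induction φ with
  | var i => rfl
  | bot => exact Term.realize_constants
  | and φ ψ h h' | or φ ψ h h' | imp φ ψ h h' =>
    rw [toTerm, Term.realize_functions_apply₂, h, h']
    rfl

theorem truthSet_imp {n : ℕ} (φ ψ : Fml n) :
    truthSet (.imp φ ψ) = (truthSet φ ⇨ truthSet ψ : Fco n) := by
  refine eq_of_forall_le_iff fun s => ?_
  rw [le_himp_iff]
  exact ⟨fun h w hw => h hw.1 w le_rfl hw.2,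
    fun h w hw v hv hφ => h ⟨s.lower hv hw, hφ⟩⟩

theorem Fml.realize_toTerm_canonicalMap_gen {n : ℕ} (φ : Fml n) :
    φ.toTerm.realize (canonicalMap n ∘ Fr.gen) = canonicalMap n (Fr.mk φ) := by
  change _ = truthSet φ
  induction φ with
  | var i => rfl
  | bot => exact Term.realize_constants
  | and φ ψ h h' | or φ ψ h h' =>
    rw [toTerm, Term.realize_functions_apply₂, h, h']
    rfl
  | imp φ ψ h h' =>
    rw [toTerm, Term.realize_functions_apply₂, h, h', truthSet_imp]
    rfl

/-- If the free Heyting algebra and its completion are elementarily equivalent, then the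
generators have the same type in both. -/
theorem realize_canonicalMap_gen_iff {n : ℕ} (h : LHA.ElementarilyEquivalent (Fr n) (Fco n))
    (θ : LHA.Formula (Fin n)) :
    θ.Realize (canonicalMap n ∘ Fr.gen) ↔ θ.Realize (Fr.gen : Fin n → Fr n) := by
  obtain ⟨Γ, hΓ⟩ := exists_formula_separatesIrreducibles (Fin n)
  have key : ∀ θ : LHA.Formula (Fin n), θ.Realize (Fr.gen : Fin n → Fr n) →
      θ.Realize (canonicalMap n ∘ Fr.gen) := by
    intro θ hθ
    let σ : LHA.Sentence := ((Γ ⊓ θ).relabel (Sum.inr : Fin n → Empty ⊕ Fin n)).iExs (Fin n)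
    have hσ : ∀ (H : Type) [HeytingAlgebra H],
        H ⊨ σ ↔ ∃ x : Fin n → H, SeparatesIrreducibles x ∧ θ.Realize x := by
      intro H _
      refine Formula.realize_iExs.trans (exists_congr fun x => ?_)
      rw [Formula.realize_relabel, Sum.elim_comp_inr, Formula.realize_inf, hΓ]
    obtain ⟨x, hx, hθx⟩ := (hσ (Fco n)).1 <| (elementarilyEquivalent_iff.1 h σ).1 <|
      (hσ (Fr n)).2 ⟨_, separatesIrreducibles_gen n, hθ⟩
    obtain ⟨e, he⟩ := exists_orderIso_of_separatesIrreducibles hx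
    rw [← e.realize_formula_iff] at hθx
    exact (funext he : e ∘ x = canonicalMap n ∘ Fr.gen) ▸ hθx
  refine ⟨fun hθ => ?_, key θ⟩
  by_contra hnot
  exact Formula.realize_not.1 (key (∼θ) (Formula.realize_not.2 hnot)) hθ

end Transfer

theorem mainTheorem7 (n : ℕ) (hn : 0 < n)
    (h : LHA.ElementarilyEquivalent (Fr n) (Fco n)) :
    ∃ f : LHA.ElementaryEmbedding (Fr n) (Fco n), ⇑f = canonicalMap n := by
  refine ⟨⟨canonicalMap n, fun m θ x => ?_⟩, rfl⟩
  choose t ht using fun j => Quotient.exists_rep (x j)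
  -- Every element is a term in the generators, so it suffices to compare the types of these.
  have key := realize_canonicalMap_gen_iff h (θ.subst fun j => (t j).toTerm)
  simp only [FirstOrder.Language.Formula.Realize,
    FirstOrder.Language.BoundedFormula.realize_subst, Fml.realize_toTerm_gen,
    Fml.realize_toTerm_canonicalMap_gen] at key
  have hx : x = fun j => Fr.mk (t j) := funext fun j => (ht j).symm
  rw [hx]
  exact key
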